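/- Let $n\ge 4$ be an integer multiple of four, and for every $x\in\{0,1\}^n$ let $\theta_x\in\mathbb{R}$ be an arbitrary angle. Let $|\psi_n\rangle\in(\mathbb{C}^2)^{\otimes n}$ be the (unnormalized) vector with amplitudes $$\langle x|\psi_n\rangle=e^{i\theta_x}\prod_{1\le a<b\le n}\left[\sin\left(\frac{\pi(a-b)}{n}\right)\right]^{2x_ax_b}\quad\text{if } |x|=n/2,\qquad \langle x|\psi_n\rangle=0\quad\text{otherwise},$$ where $|x|$ is the Hamming weight of $x$. Let $\gamma_{2p-1}=Z_1\cdots Z_{p-1}X_p$ and $\gamma_{2p}=Z_1\cdots Z_{p-1}Y_p$ $(1\le p\le n)$ be the Majorana operators, where $X_p,Y_p,Z_p$ are the Pauli operators on qubit $p$. A unit vector $|\phi\rangle\in(\mathbb{C}^2)^{\otimes n}$ is called a free-fermion state if it obeys the fermionic Wick theorem: for all $k$ and all $1\le p_1<\cdots<p_k\le 2n$, the expectation $\langle\phi|\gamma_{p_1}\cdots\gamma_{p_k}|\phi\rangle$ equals $0$ if $k$ is odd, and if $k=2m$ is even it equals $$\frac{1}{2^m m!}\sum_{\sigma\in S_{2m}}\operatorname{sgn}(\sigma)\prod_{i=1}^{m}\langle\phi|\gamma_{p_{\sigma(2i-1)}}\gamma_{p_{\sigma(2i)}}|\phi\rangle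 .$$ Then $|\psi_n\rangle$ is not proportional to a free-fermion state: there are no free-fermion state $|\phi\rangle$ and $c\in\mathbb{C}$ with $|\psi_n\rangle=c\,|\phi\rangle$. -/

import Mathlib

namespace FreeFermion

noncomputable section

/-- Vectors of the Hilbert space `(ℂ²)^{⊗ n}`, by their amplitudes `⟨x|φ⟩`, `x ∈ {0,1}ⁿ`. -/
abbrev QubitVec (n : ℕ) : Type := (Fin n → Fin 2) → ℂ

/-- Operators on `n` qubits, in the standard basis. -/
abbrev QubitOp (n : ℕ) : Type := Matrix (Fin n → Fin 2) (Fin n → Fin 2) ℂ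

/-- The Pauli matrix `X`. -/
def pauliX : Matrix (Fin 2) (Fin 2) ℂ := !![0, 1; 1, 0]

/-- The Pauli matrix `Y`. -/
def pauliY : Matrix (Fin 2) (Fin 2) ℂ := !![0, -Complex.I; Complex.I, 0]

/-- The Pauli matrix `Z`. -/
def pauliZ : Matrix (Fin 2) (Fin 2) ℂ := !![1, 0; 0, -1]

/-- The tensor product `A₁ ⊗ ⋯ ⊗ Aₙ` of single-qubit operators. -/
def tensorOp {n : ℕ} (A : Fin n → Matrix (Fin 2) (Fin 2) ℂ) : QubitOp n :=
  Matrix.of fun x y => ∏ j, A j (x j) (y j)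

/-- The Majorana operators, counted from `0`: the operator with index `2q` is
`Z₀ ⋯ Z_{q-1} X_q` and the one with index `2q + 1` is `Z₀ ⋯ Z_{q-1} Y_q`. -/
def majorana {n : ℕ} (p : Fin (2 * n)) : QubitOp n :=
  tensorOp fun j =>
    if (j : ℕ) < (p : ℕ) / 2 then pauliZ
    else if (j : ℕ) = (p : ℕ) / 2 then (if (p : ℕ) % 2 = 0 then pauliX else pauliY)
    else 1

/-- The ordered product `γ_{p₁} γ_{p₂} ⋯ γ_{pₖ}`. -/
def majoranaProd {n k : ℕ} (p : Fin k → Fin (2 * n)) : QubitOp n :=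
  (List.ofFn fun i => majorana (p i)).prod

/-- The expectation value `⟨φ|A|φ⟩`. -/
def expectation {n : ℕ} (φ : QubitVec n) (A : QubitOp n) : ℂ :=
  star φ ⬝ᵥ A.mulVec φ

/-- The antisymmetrization of `G p₁ p₂ · G p₃ p₄ ⋯ G p_{2m-1} p_{2m}` over all permutations of
`p₁, …, p_{2m}`. For `G` antisymmetric on distinct arguments and distinct `pᵢ`, the factor
`1 / (2ᵐ m!)` makes every perfect matching count once, so that for `m = 2` this is
`G p₁ p₂ * G p₃ p₄ - G p₁ p₃ * G p₂ p₄ + G p₁ p₄ * G p₂ p₃`. -/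
def antisymmetrization {ι : Type*} {m : ℕ} (G : ι → ι → ℂ) (p : Fin (2 * m) → ι) : ℂ :=
  (1 / ((2 : ℂ) ^ m * (m.factorial : ℂ))) *
    ∑ σ : Equiv.Perm (Fin (2 * m)), ((Equiv.Perm.sign σ : ℤ) : ℂ) *
      ∏ i : Fin m, G (p (σ ⟨2 * (i : ℕ), by omega⟩)) (p (σ ⟨2 * (i : ℕ) + 1, by omega⟩))

/-- A free-fermion state: a unit vector that obeys the fermionic Wick theorem. -/
structure IsFreeFermionState {n : ℕ} (φ : QubitVec n) : Prop where
  normalized : star φ ⬝ᵥ φ = 1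
  wick_odd : ∀ (k : ℕ) (p : Fin k → Fin (2 * n)), Odd k → StrictMono p →
    expectation φ (majoranaProd p) = 0
  wick_even : ∀ (m : ℕ) (p : Fin (2 * m) → Fin (2 * n)), StrictMono p →
    expectation φ (majoranaProd p) =
      antisymmetrization (fun a b => expectation φ (majorana a * majorana b)) p

/-- The Hamming weight of a bit string. -/
def hammingWeight {n : ℕ} (x : Fin n → Fin 2) : ℕ := ∑ j, (x j : ℕ)

/-- The unnormalized Haldane–Shastry state with phases `θ`. -/
def haldaneShastry (n : ℕ) (θ : (Fin n → Fin 2) → ℝ) : QubitVec n := fun x =>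
  if hammingWeight x = n / 2 then
    Complex.exp (Complex.I * (θ x : ℂ)) *
      ((∏ a : Fin n, ∏ b ∈ Finset.Ioi a,
        Real.sin (Real.pi * (((a : ℕ) : ℝ) - ((b : ℕ) : ℝ)) / (n : ℝ)) ^
          (2 * (x a : ℕ) * (x b : ℕ)) : ℝ) : ℂ)
  else 0

end

end FreeFermion

namespace FreeFermion

open Matrix

/-! The obstruction is a quadratic (Plücker-type) relation among amplitudes. Let `G a b` be the
two-point functions of a free-fermion state `φ` supported on weight `n / 2`. Then `∑ Z_q`
annihilates `φ`, so both `∑ ⟨Z_q⟩` and `∑ ⟨Z_p Z_q⟩` vanish. Expanding the latter by Wick's theorem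
shows that the mixed terms needed to complete squares in `∑ G a b ^ 2` sum to zero. The completed
squares are squares of purely imaginary numbers, so the sum is at most `0`; but it is also the
squared norm of `∑ γₐφ ⊗ γₐφ`. Hence this tensor vanishes
(`IsFreeFermionState.majoranaTensor_eq_zero`).

One component of the tensor, at two strings differing exactly on the sites `0, 1, 2, 3`, is a
three-term relation between products of amplitudes. Its triangle inequality is
`IsFreeFermionState.norm_mul_le`, in which all phases have disappeared. For the Haldane–Shastry
moduli, the three products are a common positive factor times products of squared chords
(`hsWeight_mul`). Ptolemy's theorem makes the product of the diagonals the sum of the products of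
opposite sides; after squaring, the positive cross term breaks the triangle inequality
(`chordSq_lt`). -/

/-! ### Majorana operators as signed bit flips. -/

/-- The sign `(-1)^b` of a bit `b`. -/
noncomputable def bitSign (b : Fin 2) : ℂ := if b = 0 then 1 else -1

/-- The bit string `x` with its `q`-th bit flipped. -/
def flipBit {n : ℕ} (q : Fin n) (x : Fin n → Fin 2) : Fin n → Fin 2 :=
  Function.update x q (1 - x q)

/-- The Jordan–Wigner sign of the bits of `x` before position `q`. -/
noncomputable def jwSign {n : ℕ} (q : Fin n) (x : Fin n → Fin 2) : ℂ :=
  ∏ j ∈ Finset.Iio q, bitSign (x j)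

/-- The index of the Majorana operator given by a qubit and a choice of `X` (`0`) or `Y` (`1`). -/
def majIndex {n : ℕ} (q : Fin n) (s : Fin 2) : Fin (2 * n) := ⟨2 * q + s, by omega⟩

/-- The factor by which a Majorana operator of type `s` acts on a bit `b`. -/
noncomputable def bitFactor (s b : Fin 2) : ℂ := if s = 0 then 1 else -Complex.I * bitSign b

lemma bitSign_mul_self (b : Fin 2) : bitSign b * bitSign b = 1 := by
  fin_cases b <;> simp [bitSign]

lemma bitSign_one_sub (b : Fin 2) : bitSign (1 - b) = -bitSign b := by
  fin_cases b <;> simp [bitSign]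

lemma flipBit_self {n : ℕ} (q : Fin n) (x : Fin n → Fin 2) : flipBit q x q = 1 - x q := by
  simp [flipBit]

lemma flipBit_of_ne {n : ℕ} {q j : Fin n} (h : j ≠ q) (x : Fin n → Fin 2) :
    flipBit q x j = x j := by
  simp [flipBit, h]

lemma flipBit_flipBit {n : ℕ} (q : Fin n) (x : Fin n → Fin 2) : flipBit q (flipBit q x) = x := by
  simp [flipBit]

lemma flipBit_comm {n : ℕ} {p q : Fin n} (h : p ≠ q) (x : Fin n → Fin 2) :
    flipBit p (flipBit q x) = flipBit q (flipBit p x) := by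
  simp only [flipBit, Function.update_of_ne h, Function.update_of_ne h.symm]
  exact Function.update_comm h.symm _ _ _

lemma jwSign_mul_self {n : ℕ} (q : Fin n) (x : Fin n → Fin 2) : jwSign q x * jwSign q x = 1 := by
  simp [jwSign, ← Finset.prod_mul_distrib, bitSign_mul_self]

lemma jwSign_flipBit_of_le {n : ℕ} {p q : Fin n} (h : q ≤ p) (x : Fin n → Fin 2) :
    jwSign q (flipBit p x) = jwSign q x := by
  refine Finset.prod_congr rfl fun j hj => ?_
  rw [flipBit_of_ne (by simp at hj; omega)]

lemma jwSign_flipBit_of_lt {n : ℕ} {p q : Fin n} (h : p < q) (x : Fin n → Fin 2) :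
    jwSign q (flipBit p x) = -jwSign q x := by
  have hp : p ∈ Finset.Iio q := by simpa using h
  rw [jwSign, jwSign, ← Finset.mul_prod_erase _ _ hp, ← Finset.mul_prod_erase _ _ hp,
    flipBit_self, bitSign_one_sub, neg_mul]
  congr 2
  refine Finset.prod_congr rfl fun j hj => ?_
  rw [flipBit_of_ne (Finset.ne_of_mem_erase hj)]

/-- Row `x` of the operator has a single nonzero entry, in column `flipBit q x`: the `Z` string
contributes the Jordan–Wigner sign and the `X` or `Y` at `q` contributes `bitFactor`. -/
lemma majorana_mulVec {n : ℕ} (q : Fin n) (s : Fin 2) (φ : QubitVec n) (x : Fin n → Fin 2) :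
    (majorana (majIndex q s) *ᵥ φ) x = jwSign q x * bitFactor s (x q) * φ (flipBit q x) := by
  have h1 : ((majIndex q s : Fin (2 * n)) : ℕ) / 2 = q := by simp only [majIndex]; omega
  have h2 : ((majIndex q s : Fin (2 * n)) : ℕ) % 2 = s := by simp only [majIndex]; omega
  rw [Matrix.mulVec, dotProduct, Finset.sum_eq_single (flipBit q x)]
  · congr 1
    simp only [majorana, tensorOp, Matrix.of_apply, h1, h2]
    rw [← Finset.mul_prod_erase _ _ (Finset.mem_univ q), mul_comm]
    congr 1
    · rw [jwSign, ← Finset.prod_subset (s₁ := Finset.Iio q)]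
      · refine Finset.prod_congr rfl fun j hj => ?_
        have hj' : j < q := by simpa using hj
        rw [flipBit_of_ne hj'.ne, if_pos (by simpa using hj')]
        generalize x j = b
        fin_cases b <;> simp [pauliZ, bitSign]
      · intro j hj
        simp at hj ⊢
        exact hj.ne
      · intro j hj hj'
        have h3 : j ≠ q := Finset.ne_of_mem_erase hj
        have h4 : ¬ (j : ℕ) < q := by simpa using hj'
        have h5 : ¬ (j : ℕ) = q := fun h => h3 (Fin.ext h)
        rw [if_neg h4, if_neg h5, flipBit_of_ne h3, Matrix.one_apply_eq]
    · simp only [lt_irrefl, if_false, if_true, flipBit_self]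
      generalize x q = b
      fin_cases b <;> fin_cases s <;> simp [pauliX, pauliY, bitFactor, bitSign]
  · intro y _ hy
    obtain ⟨j, hj⟩ := Function.ne_iff.mp hy
    refine mul_eq_zero_of_left ?_ _
    simp only [majorana, tensorOp, Matrix.of_apply, h1, h2]
    refine Finset.prod_eq_zero (Finset.mem_univ j) ?_
    by_cases hq : j = q
    · subst hq
      rw [flipBit_self] at hj
      simp only [lt_irrefl, if_false, if_true]
      generalize x j = b at *
      generalize y j = c at *
      revert hj
      fin_cases b <;> fin_cases s <;> fin_cases c <;> simp [pauliX, pauliY]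
    · rw [flipBit_of_ne hq] at hj
      have h5 : ¬ (j : ℕ) = q := fun h => hq (Fin.ext h)
      simp only [h5, if_false]
      split_ifs
      · generalize x j = b at *
        generalize y j = c at *
        revert hj
        fin_cases b <;> fin_cases c <;> simp [pauliZ]
      · exact Matrix.one_apply_ne hj.symm
  · simp

lemma majorana_mulVec_self {n : ℕ} (q : Fin n) (s : Fin 2) (φ : QubitVec n) :
    majorana (majIndex q s) *ᵥ (majorana (majIndex q s) *ᵥ φ) = φ := by
  ext x
  rw [majorana_mulVec, majorana_mulVec, flipBit_flipBit, jwSign_flipBit_of_le le_rfl, flipBit_self]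
  have h := jwSign_mul_self q x
  have h' : bitFactor s (x q) * bitFactor s (1 - x q) = 1 := by
    generalize x q = b
    fin_cases b <;> fin_cases s <;> simp [bitFactor, bitSign]
  linear_combination φ x * jwSign q x * jwSign q x * h' + φ x * h

/-- The strings cancel and `X Y = i Z`, so quadratic Majorana expressions recover `Z_q`. -/
lemma majorana_mulVec_pair {n : ℕ} (q : Fin n) (φ : QubitVec n) (x : Fin n → Fin 2) :
    (majorana (majIndex q 0) *ᵥ (majorana (majIndex q 1) *ᵥ φ)) x =
      Complex.I * bitSign (x q) * φ x := by
  rw [majorana_mulVec, majorana_mulVec, flipBit_flipBit, jwSign_flipBit_of_le le_rfl, flipBit_self]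
  have h := jwSign_mul_self q x
  simp only [bitFactor, bitSign_one_sub, if_true, one_ne_zero, if_false]
  linear_combination Complex.I * bitSign (x q) * φ x * h

/-- On different qubits, the flip at the smaller index reverses the string sign of the larger one.
On the same qubit, this is `X Y = -Y X`. -/
lemma majorana_mulVec_anticomm {n : ℕ} {p q : Fin n} {s t : Fin 2} (h : (p, s) ≠ (q, t))
    (φ : QubitVec n) :
    majorana (majIndex p s) *ᵥ (majorana (majIndex q t) *ᵥ φ) =
      -(majorana (majIndex q t) *ᵥ (majorana (majIndex p s) *ᵥ φ)) := by
  ext x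
  rw [Pi.neg_apply, majorana_mulVec, majorana_mulVec, majorana_mulVec, majorana_mulVec]
  rcases lt_trichotomy p q with hpq | rfl | hpq
  · rw [jwSign_flipBit_of_lt hpq, jwSign_flipBit_of_le hpq.le, flipBit_of_ne hpq.ne,
      flipBit_of_ne hpq.ne', flipBit_comm hpq.ne]
    ring
  · have hst : s ≠ t := fun hst => h (by rw [hst])
    rw [flipBit_flipBit, jwSign_flipBit_of_le le_rfl, flipBit_self]
    have h' : bitFactor s (x p) * bitFactor t (1 - x p) =
        -(bitFactor t (x p) * bitFactor s (1 - x p)) := by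
      generalize x p = b
      revert hst
      fin_cases b <;> fin_cases s <;> fin_cases t <;> simp [bitFactor, bitSign]
    linear_combination jwSign p x * jwSign p x * φ x * h'
  · rw [jwSign_flipBit_of_lt hpq, jwSign_flipBit_of_le hpq.le, flipBit_of_ne hpq.ne,
      flipBit_of_ne hpq.ne', flipBit_comm hpq.ne]
    ring

lemma majorana_conjTranspose {n : ℕ} (p : Fin (2 * n)) : (majorana p)ᴴ = majorana p := by
  ext x y
  simp only [Matrix.conjTranspose_apply, majorana, tensorOp, Matrix.of_apply, star_prod]
  refine Finset.prod_congr rfl fun j _ => ?_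
  generalize x j = b
  generalize y j = c
  split_ifs <;> fin_cases b <;> fin_cases c <;> simp [pauliX, pauliY, pauliZ]

/-! ### Two-point functions. -/

/-- The inner product of two majorana images is a two-point function. -/
lemma expectation_majorana_mul {n : ℕ} (φ : QubitVec n) (a b : Fin (2 * n)) :
    expectation φ (majorana a * majorana b) =
      star (majorana a *ᵥ φ) ⬝ᵥ (majorana b *ᵥ φ) := by
  rw [expectation, ← Matrix.mulVec_mulVec, Matrix.star_mulVec, majorana_conjTranspose,
    Matrix.dotProduct_mulVec]

lemma expectation_majorana_mul_self {n : ℕ} {φ : QubitVec n} (hφ : star φ ⬝ᵥ φ = 1)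
    (q : Fin n) (s : Fin 2) :
    expectation φ (majorana (majIndex q s) * majorana (majIndex q s)) = 1 := by
  rw [expectation, ← Matrix.mulVec_mulVec, majorana_mulVec_self, hφ]

lemma expectation_majorana_mul_comm {n : ℕ} (φ : QubitVec n) {p q : Fin n} {s t : Fin 2}
    (h : (p, s) ≠ (q, t)) :
    expectation φ (majorana (majIndex p s) * majorana (majIndex q t)) =
      -expectation φ (majorana (majIndex q t) * majorana (majIndex p s)) := by
  rw [expectation, expectation, ← Matrix.mulVec_mulVec, ← Matrix.mulVec_mulVec,
    majorana_mulVec_anticomm h, dotProduct_neg]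

lemma star_expectation_majorana_mul {n : ℕ} (φ : QubitVec n) (a b : Fin (2 * n)) :
    star (expectation φ (majorana a * majorana b)) = expectation φ (majorana b * majorana a) := by
  rw [expectation_majorana_mul, expectation_majorana_mul, Matrix.star_dotProduct, star_star,
    dotProduct_comm]

/-- Hermiticity makes conjugation swap the two operators, and anticommutation makes the swap a sign
change; so the value is purely imaginary. -/
lemma re_expectation_majorana_mul {n : ℕ} (φ : QubitVec n) {p q : Fin n} {s t : Fin 2}
    (h : (p, s) ≠ (q, t)) :
    (expectation φ (majorana (majIndex p s) * majorana (majIndex q t))).re = 0 := by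
  have h1 := congrArg Complex.re
    (star_expectation_majorana_mul φ (majIndex p s) (majIndex q t))
  have h2 := congrArg Complex.re (expectation_majorana_mul_comm φ h)
  simp only [Complex.star_def, Complex.conj_re, Complex.neg_re] at h1 h2
  linarith

/-! ### Wick's theorem for four operators. -/

lemma sum_perm_four (f : Equiv.Perm (Fin 4) → ℂ) : ∑ σ, f σ =
    ∑ i : Fin 4, ∑ j : Fin 3, ∑ k : Fin 2, f (Equiv.Perm.decomposeFin.symm (i,
      Equiv.Perm.decomposeFin.symm (j, Equiv.Perm.decomposeFin.symm (k, 1)))) := by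
  rw [← Equiv.Perm.decomposeFin.symm.sum_comp, Fintype.sum_prod_type]
  refine Finset.sum_congr rfl fun i _ => ?_
  rw [← Equiv.Perm.decomposeFin.symm.sum_comp, Fintype.sum_prod_type]
  refine Finset.sum_congr rfl fun j _ => ?_
  rw [← Equiv.Perm.decomposeFin.symm.sum_comp, Fintype.sum_prod_type]
  refine Finset.sum_congr rfl fun k _ => ?_
  rw [Fintype.sum_unique]
  rfl

/-- Each of the three perfect matchings arises from `2² · 2! = 8` permutations, all contributing the
same signed term. -/
lemma sum_perm_four_sign_mul (g : Fin 4 → Fin 4 → ℂ) (hg : ∀ i j, i ≠ j → g i j = -g j i) :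
    ∑ σ : Equiv.Perm (Fin 4), ((Equiv.Perm.sign σ : ℤ) : ℂ) * (g (σ 0) (σ 1) * g (σ 2) (σ 3)) =
      8 * (g 0 1 * g 2 3 - g 0 2 * g 1 3 + g 0 3 * g 1 2) := by
  rw [sum_perm_four]
  simp only [Fin.sum_univ_four, Fin.sum_univ_three, Fin.sum_univ_two,
    Equiv.Perm.decomposeFin.symm_sign]
  have a2 : ∀ i e, Equiv.Perm.decomposeFin.symm (i, e) (2 : Fin 4) = Equiv.swap 0 i (e 1).succ :=
    fun i e => Equiv.Perm.decomposeFin_symm_apply_succ e i 1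
  have a3 : ∀ i e, Equiv.Perm.decomposeFin.symm (i, e) (3 : Fin 4) = Equiv.swap 0 i (e 2).succ :=
    fun i e => Equiv.Perm.decomposeFin_symm_apply_succ e i 2
  have b2 : ∀ i e, Equiv.Perm.decomposeFin.symm (i, e) (2 : Fin 3) = Equiv.swap 0 i (e 1).succ :=
    fun i e => Equiv.Perm.decomposeFin_symm_apply_succ e i 1
  simp only [a2, a3, b2, Equiv.Perm.decomposeFin_symm_apply_zero,
    Equiv.Perm.decomposeFin_symm_apply_one,
    Equiv.swap_apply_def, Equiv.Perm.one_apply, Fin.reduceEq, if_true, if_false, Fin.succ_zero_eq_one,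
    Fin.succ_one_eq_two, Fin.reduceSucc, one_ne_zero, map_one, Units.val_one,
    Units.val_neg, mul_one, one_mul, neg_mul, mul_neg, Int.cast_one,
    Int.cast_neg, neg_neg]
  rw [hg 1 0 (by decide), hg 2 0 (by decide), hg 3 0 (by decide), hg 2 1 (by decide),
    hg 3 1 (by decide), hg 3 2 (by decide)]
  ring

/-- The fourfold antisymmetrization of an antisymmetric function is a sum over three pairings. -/
lemma antisymmetrization_four {ι : Type*} (G : ι → ι → ℂ) (p : Fin 4 → ι)
    (hG : ∀ i j, i ≠ j → G (p i) (p j) = -G (p j) (p i)) :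
    antisymmetrization (m := 2) G p =
      G (p 0) (p 1) * G (p 2) (p 3) - G (p 0) (p 2) * G (p 1) (p 3)
        + G (p 0) (p 3) * G (p 1) (p 2) := by
  have h := sum_perm_four_sign_mul (fun i j => G (p i) (p j)) hG
  simp only [antisymmetrization, Fin.prod_univ_two]
  refine (congrArg _ h).trans ?_
  norm_num [Nat.factorial]
  ring

/-- The two-point functions of a state. -/
noncomputable def twoPoint {n : ℕ} (φ : QubitVec n) (a b : Fin n × Fin 2) : ℂ :=
  expectation φ (majorana (majIndex a.1 a.2) * majorana (majIndex b.1 b.2))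

lemma expectation_pair {n : ℕ} (φ : QubitVec n) (q : Fin n) :
    twoPoint φ (q, 0) (q, 1) = ∑ x, star (φ x) * (Complex.I * bitSign (x q) * φ x) := by
  rw [twoPoint, expectation, ← Matrix.mulVec_mulVec, dotProduct]
  simp only [majorana_mulVec_pair, Pi.star_apply]

lemma twoPoint_comm {n : ℕ} (φ : QubitVec n) {a b : Fin n × Fin 2} (h : a ≠ b) :
    twoPoint φ a b = -twoPoint φ b a :=
  expectation_majorana_mul_comm φ h

lemma twoPoint_self {n : ℕ} {φ : QubitVec n} (hφ : star φ ⬝ᵥ φ = 1) (a : Fin n × Fin 2) :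
    twoPoint φ a a = 1 :=
  expectation_majorana_mul_self hφ a.1 a.2

/-- The Wick theorem for `Z_p Z_q`, `p < q`. -/
lemma IsFreeFermionState.wick_pair_of_lt {n : ℕ} {φ : QubitVec n} (hφ : IsFreeFermionState φ)
    {p q : Fin n} (hpq : p < q) :
    ∑ x, star (φ x) * ((Complex.I * bitSign (x p)) * (Complex.I * bitSign (x q)) * φ x) =
      twoPoint φ (p, 0) (p, 1) * twoPoint φ (q, 0) (q, 1)
        - twoPoint φ (p, 0) (q, 0) * twoPoint φ (p, 1) (q, 1)
        + twoPoint φ (p, 0) (q, 1) * twoPoint φ (p, 1) (q, 0) := by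
  let f : Fin 4 → Fin n × Fin 2 := ![(p, 0), (p, 1), (q, 0), (q, 1)]
  have hf : Function.Injective f := by
    intro i j
    have := hpq.ne
    have := hpq.ne'
    fin_cases i <;> fin_cases j <;> simp_all [f]
  have hmono : StrictMono fun i => majIndex (f i).1 (f i).2 := by
    have h : (p : ℕ) < q := hpq
    refine Fin.strictMono_iff_lt_succ.mpr fun i => ?_
    rw [Fin.lt_def]
    fin_cases i <;> (simp [f, majIndex]; try omega)
  have hw := (hφ.wick_even 2 (fun i : Fin 4 => majIndex (f i).1 (f i).2) hmono).trans
    (antisymmetrization_four _ (fun i : Fin 4 => majIndex (f i).1 (f i).2) fun i j hij =>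
      twoPoint_comm φ (hf.ne hij))
  refine Eq.trans ?_ hw
  rw [majoranaProd, expectation, dotProduct]
  refine Finset.sum_congr rfl fun x _ => ?_
  rw [Pi.star_apply]
  congr 1
  simp only [List.ofFn_succ, Nat.reduceMul, List.ofFn_zero, List.prod_cons, List.prod_nil,
    mul_one, ← Matrix.mulVec_mulVec]
  have h1 := majorana_mulVec_pair p
    (majorana (majIndex q 0) *ᵥ (majorana (majIndex q 1) *ᵥ φ)) x
  refine Eq.trans ?_ h1.symm
  rw [majorana_mulVec_pair, mul_assoc]

/-- Removing the order on `p, q` allows summation over all pairs. The diagonal is not an instance of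
Wick's theorem: there both sides equal `-1`, since `γ² = 1` and the other two terms cancel by
anticommutation. -/
lemma IsFreeFermionState.wick_pair {n : ℕ} {φ : QubitVec n} (hφ : IsFreeFermionState φ)
    (p q : Fin n) :
    ∑ x, star (φ x) * ((Complex.I * bitSign (x p)) * (Complex.I * bitSign (x q)) * φ x) =
      twoPoint φ (p, 0) (p, 1) * twoPoint φ (q, 0) (q, 1)
        - twoPoint φ (p, 0) (q, 0) * twoPoint φ (p, 1) (q, 1)
        + twoPoint φ (p, 0) (q, 1) * twoPoint φ (p, 1) (q, 0) := by
  rcases lt_trichotomy p q with hpq | rfl | hpq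
  · exact hφ.wick_pair_of_lt hpq
  · rw [twoPoint_self hφ.normalized, twoPoint_self hφ.normalized,
      twoPoint_comm φ (a := (p, 1)) (b := (p, 0)) (by simp)]
    have h := hφ.normalized
    rw [dotProduct] at h
    simp only [Pi.star_apply] at h
    have h' : ∀ x : Fin n → Fin 2, star (φ x) *
        ((Complex.I * bitSign (x p)) * (Complex.I * bitSign (x p)) * φ x) =
          -(star (φ x) * φ x) := fun x => by
      linear_combination star (φ x) * φ x * bitSign (x p) * bitSign (x p) * Complex.I_mul_I
        - star (φ x) * φ x * bitSign_mul_self (x p)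
    rw [Finset.sum_congr rfl fun x _ => h' x, Finset.sum_neg_distrib, h]
    ring
  · have h := hφ.wick_pair_of_lt hpq
    have hc : ∀ s t, twoPoint φ (q, s) (p, t) = -twoPoint φ (p, t) (q, s) := fun s t =>
      twoPoint_comm φ (by simp [hpq.ne])
    rw [hc, hc, hc, hc] at h
    rw [← sub_eq_zero] at h ⊢
    rw [← h]
    have : ∀ x : Fin n → Fin 2, star (φ x) *
        ((Complex.I * bitSign (x p)) * (Complex.I * bitSign (x q)) * φ x) = star (φ x) *
        ((Complex.I * bitSign (x q)) * (Complex.I * bitSign (x p)) * φ x) := fun x => by ring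
    rw [Finset.sum_congr rfl fun x _ => this x]
    ring

/-! ### Vanishing of the Majorana tensor. -/

/-- The components of `∑ₐ γₐ φ ⊗ γₐ φ`. -/
noncomputable def majoranaTensor {n : ℕ} (φ : QubitVec n) (x y : Fin n → Fin 2) : ℂ :=
  ∑ a : Fin n × Fin 2,
    (majorana (majIndex a.1 a.2) *ᵥ φ) x * (majorana (majIndex a.1 a.2) *ᵥ φ) y

/-- The norm of a sum of product vectors `v ⊗ v` expands into squared inner products. These are
complex squares, not squared moduli, so the right side has no evident sign. -/
lemma sum_star_majoranaTensor_mul_self {n : ℕ} (φ : QubitVec n) :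
    ∑ x, ∑ y, star (majoranaTensor φ x y) * majoranaTensor φ x y =
      ∑ a, ∑ b, twoPoint φ a b ^ 2 := by
  simp only [twoPoint, expectation_majorana_mul, dotProduct, Pi.star_apply, majoranaTensor,
    star_sum, star_mul', Finset.sum_mul_sum, pow_two]
  calc _ = ∑ x, ∑ a : Fin n × Fin 2, ∑ y, ∑ b : Fin n × Fin 2, _ :=
        Finset.sum_congr rfl fun x _ => Finset.sum_comm
    _ = ∑ a : Fin n × Fin 2, ∑ x, ∑ y, ∑ b : Fin n × Fin 2, _ := Finset.sum_comm
    _ = ∑ a : Fin n × Fin 2, ∑ x, ∑ b : Fin n × Fin 2, ∑ y, _ :=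
        Finset.sum_congr rfl fun a _ => Finset.sum_congr rfl fun x _ => Finset.sum_comm
    _ = ∑ a : Fin n × Fin 2, ∑ b : Fin n × Fin 2, ∑ x, ∑ y, _ :=
        Finset.sum_congr rfl fun a _ => Finset.sum_comm
    _ = _ := by
      refine Finset.sum_congr rfl fun a _ => Finset.sum_congr rfl fun b _ =>
        Finset.sum_congr rfl fun x _ => Finset.sum_congr rfl fun y _ => ?_
      ring

lemma re_sq_nonpos_of_re_eq_zero {z : ℂ} (h : z.re = 0) : (z ^ 2).re ≤ 0 := by
  rw [pow_two, Complex.mul_re, h]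
  nlinarith [mul_self_nonneg z.im]

/-- A free-fermion state annihilated by `∑_q Z_q` satisfies `∑ₐ γₐ φ ⊗ γₐ φ = 0`. -/
theorem IsFreeFermionState.majoranaTensor_eq_zero {n : ℕ} {φ : QubitVec n}
    (hφ : IsFreeFermionState φ) (hz : ∀ x, φ x ≠ 0 → ∑ q, bitSign (x q) = 0)
    (x y : Fin n → Fin 2) : majoranaTensor φ x y = 0 := by
  have hz' : ∀ x, (Complex.I * ∑ q, bitSign (x q)) * φ x = 0 := fun x => by
    by_cases h : φ x = 0
    · simp [h]
    · rw [hz x h]; simp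
  have hpair : ∑ q, twoPoint φ (q, 0) (q, 1) = 0 := by
    simp only [expectation_pair]
    rw [Finset.sum_comm]
    simp only [← Finset.mul_sum, ← Finset.sum_mul, hz', mul_zero, Finset.sum_const_zero]
  have hzz : ∑ p, ∑ q, ∑ x, star (φ x) *
      ((Complex.I * bitSign (x p)) * (Complex.I * bitSign (x q)) * φ x) = 0 := by
    refine Finset.sum_eq_zero fun p _ => ?_
    rw [Finset.sum_comm]
    refine Finset.sum_eq_zero fun x _ => ?_
    have := hz' x
    simp only [mul_assoc, ← Finset.mul_sum, ← Finset.sum_mul] at this ⊢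
    rw [this]; simp
  -- The first Wick term factors into `(∑ ⟨i Z_q⟩)²`, which is zero; only the two mixed terms
  -- remain.
  simp only [hφ.wick_pair, Finset.sum_add_distrib, Finset.sum_sub_distrib, ← Finset.mul_sum,
    hpair, mul_zero, zero_sub,
    Finset.sum_neg_distrib] at hzz
  have hsum : ∑ a, ∑ b, twoPoint φ a b ^ 2 = ∑ p, ∑ q,
      ((twoPoint φ (p, 0) (q, 0) - twoPoint φ (p, 1) (q, 1)) ^ 2
        + (twoPoint φ (p, 0) (q, 1) + twoPoint φ (p, 1) (q, 0)) ^ 2) := by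
    have h1 : ∑ a, ∑ b, twoPoint φ a b ^ 2 = ∑ p, ∑ q,
        (twoPoint φ (p, 0) (q, 0) ^ 2 + twoPoint φ (p, 0) (q, 1) ^ 2
          + twoPoint φ (p, 1) (q, 0) ^ 2 + twoPoint φ (p, 1) (q, 1) ^ 2) := by
      simp only [Fintype.sum_prod_type, Fin.sum_univ_two, ← Finset.sum_add_distrib]
      refine Finset.sum_congr rfl fun p _ => Finset.sum_congr rfl fun q _ => ?_
      ring
    -- Twice the mixed terms is exactly what completes the squares, and it sums to zero.
    have h2 : ∑ p, ∑ q, (2 * (-(twoPoint φ (p, 0) (q, 0) * twoPoint φ (p, 1) (q, 1))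
        + twoPoint φ (p, 0) (q, 1) * twoPoint φ (p, 1) (q, 0))) = 0 := by
      simp only [← Finset.mul_sum, Finset.sum_add_distrib, Finset.sum_neg_distrib]
      rw [hzz, mul_zero]
    rw [h1, ← add_zero (∑ p, ∑ q, (_ : ℂ)), ← h2, ← Finset.sum_add_distrib]
    refine Finset.sum_congr rfl fun p _ => ?_
    rw [← Finset.sum_add_distrib]
    refine Finset.sum_congr rfl fun q _ => ?_
    ring
  have hle : (∑ a, ∑ b, twoPoint φ a b ^ 2).re ≤ 0 := by
    rw [hsum, Complex.re_sum]
    refine Finset.sum_nonpos fun p _ => ?_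
    rw [Complex.re_sum]
    refine Finset.sum_nonpos fun q _ => ?_
    rw [Complex.add_re]
    have hre : ∀ a b : Fin n × Fin 2, a ≠ b → (twoPoint φ a b).re = 0 := fun a b hab =>
      re_expectation_majorana_mul φ hab
    have h1 : (twoPoint φ (p, 0) (q, 0) - twoPoint φ (p, 1) (q, 1)).re = 0 := by
      -- On the diagonal the two-point functions are `1`, not imaginary, but their difference
      -- vanishes.
      by_cases hpq : p = q
      · rw [hpq, twoPoint_self hφ.normalized, twoPoint_self hφ.normalized, sub_self,
          Complex.zero_re]
      · rw [Complex.sub_re, hre _ _ (by simp [hpq]), hre _ _ (by simp [hpq]), sub_self]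
    have h2 : (twoPoint φ (p, 0) (q, 1) + twoPoint φ (p, 1) (q, 0)).re = 0 := by
      rw [Complex.add_re, hre _ _ (by simp), hre _ _ (by simp), add_zero]
    linarith [re_sq_nonpos_of_re_eq_zero h1, re_sq_nonpos_of_re_eq_zero h2]
  rw [← sum_star_majoranaTensor_mul_self] at hle
  have hsq : ∀ z : ℂ, (star z * z).re = Complex.normSq z := fun z => by
    rw [Complex.star_def, mul_comm, Complex.mul_conj, Complex.ofReal_re]
  simp only [Complex.re_sum, hsq] at hle
  have hnn : ∀ x, 0 ≤ ∑ y, Complex.normSq (majoranaTensor φ x y) := fun x =>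
    Finset.sum_nonneg fun y _ => Complex.normSq_nonneg _
  have h0 := (Finset.sum_eq_zero_iff_of_nonneg fun x _ => hnn x).mp
    (le_antisymm hle (Finset.sum_nonneg fun x _ => hnn x)) x (Finset.mem_univ x)
  exact Complex.normSq_eq_zero.mp
    ((Finset.sum_eq_zero_iff_of_nonneg fun y _ => Complex.normSq_nonneg _).mp h0 y
      (Finset.mem_univ y))

lemma majoranaTensor_apply {n : ℕ} (φ : QubitVec n) (x y : Fin n → Fin 2) :
    majoranaTensor φ x y = ∑ q, jwSign q x * jwSign q y *
      (1 - bitSign (x q) * bitSign (y q)) * (φ (flipBit q x) * φ (flipBit q y)) := by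
  rw [majoranaTensor, Fintype.sum_prod_type]
  refine Finset.sum_congr rfl fun q _ => ?_
  simp only [Fin.sum_univ_two, majorana_mulVec, bitFactor, if_true, one_ne_zero, if_false]
  linear_combination jwSign q x * jwSign q y * bitSign (x q) * bitSign (y q) *
    (φ (flipBit q x) * φ (flipBit q y)) * Complex.I_mul_I

lemma norm_jwSign {n : ℕ} (q : Fin n) (x : Fin n → Fin 2) : ‖jwSign q x‖ = 1 := by
  rw [jwSign, norm_prod]
  refine Finset.prod_eq_one fun j _ => ?_
  generalize x j = b
  fin_cases b <;> simp [bitSign]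

/-! ### Moduli of the Haldane–Shastry amplitudes. -/

/-- The modulus of the Haldane–Shastry amplitude of a bit string of weight `n / 2`. -/
noncomputable def hsWeight (n : ℕ) (x : Fin n → Fin 2) : ℝ :=
  ∏ a : Fin n, ∏ b ∈ Finset.Ioi a,
    Real.sin (Real.pi * (((a : ℕ) : ℝ) - ((b : ℕ) : ℝ)) / (n : ℝ)) ^ (2 * (x a : ℕ) * (x b : ℕ))

/-- The squared chord length between two sites. -/
noncomputable def chordSq (n a b : ℕ) : ℝ := Real.sin (Real.pi * ((a : ℝ) - (b : ℝ)) / (n : ℝ)) ^ 2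

lemma chordSq_pos {n a b : ℕ} (hab : a < b) (hb : b < n) : 0 < chordSq n a b := by
  have hn : (0 : ℝ) < n := by exact_mod_cast (by omega : 0 < n)
  have h1 : (a : ℝ) < b := by exact_mod_cast hab
  have h2 : (b : ℝ) < n := by exact_mod_cast hb
  have h3 : (0 : ℝ) ≤ a := Nat.cast_nonneg a
  have : Real.pi * ((a : ℝ) - b) / n = -(Real.pi * ((b : ℝ) - a) / n) := by ring
  rw [chordSq, this, Real.sin_neg, neg_sq]
  refine pow_pos (Real.sin_pos_of_pos_of_lt_pi ?_ ?_) 2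
  · have := Real.pi_pos
    have : 0 < (b : ℝ) - a := by linarith
    positivity
  · rw [div_lt_iff₀ hn]
    exact mul_lt_mul_of_pos_left (by linarith) Real.pi_pos

lemma hsWeight_eq {n : ℕ} (x : Fin n → Fin 2) :
    hsWeight n x = ∏ a : Fin n, ∏ b ∈ Finset.Ioi a, chordSq n a b ^ ((x a : ℕ) * (x b : ℕ)) := by
  simp only [hsWeight, chordSq, ← pow_mul, mul_assoc]

lemma norm_haldaneShastry {n : ℕ} (θ : (Fin n → Fin 2) → ℝ) (x : Fin n → Fin 2)
    (hx : hammingWeight x = n / 2) : ‖haldaneShastry n θ x‖ = hsWeight n x := by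
  have h0 : 0 ≤ hsWeight n x := by
    rw [hsWeight_eq]
    exact Finset.prod_nonneg fun a _ => Finset.prod_nonneg fun b _ => pow_nonneg (sq_nonneg _) _
  rw [haldaneShastry, if_pos hx, norm_mul, mul_comm Complex.I, Complex.norm_exp_ofReal_mul_I,
    one_mul, Complex.norm_real, ← hsWeight, Real.norm_of_nonneg h0]

/-- The bit string with ones at the sites of `T ⊆ {0, 1, 2, 3}` and at the sites
`4, …, n / 2 + 1`. -/
def blockString (n : ℕ) (T : Finset ℕ) : Fin n → Fin 2 :=
  fun a => if (a : ℕ) ∈ T ∨ (4 ≤ (a : ℕ) ∧ (a : ℕ) < n / 2 + 2) then 1 else 0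

lemma hammingWeight_blockString {n : ℕ} (hn : 4 ≤ n) {T : Finset ℕ} (hT : T ⊆ Finset.range 4) :
    hammingWeight (blockString n T) = T.card + (n / 2 - 2) := by
  have h : ∀ a : Fin n, ((blockString n T a : Fin 2) : ℕ) =
      if (a : ℕ) ∈ T ∪ Finset.Ico 4 (n / 2 + 2) then 1 else 0 := fun a => by
    simp only [blockString, Finset.mem_union, Finset.mem_Ico]
    split_ifs <;> rfl
  rw [hammingWeight, Finset.sum_congr rfl fun a _ => h a,
    Fin.sum_univ_eq_sum_range (fun a => if a ∈ T ∪ Finset.Ico 4 (n / 2 + 2) then 1 else 0) n,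
    Finset.sum_ite_mem, Finset.sum_const, smul_eq_mul, mul_one]
  have hsub : T ∪ Finset.Ico 4 (n / 2 + 2) ⊆ Finset.range n := by
    intro a ha
    rcases Finset.mem_union.mp ha with ha | ha
    · have := Finset.mem_range.mp (hT ha)
      exact Finset.mem_range.mpr (by omega)
    · have := Finset.mem_Ico.mp ha
      exact Finset.mem_range.mpr (by omega)
  rw [Finset.inter_eq_right.mpr hsub, Finset.card_union_of_disjoint, Nat.card_Ico]
  · omega
  · refine Finset.disjoint_left.mpr fun a ha ha' => ?_
    have := Finset.mem_range.mp (hT ha)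
    have := Finset.mem_Ico.mp ha'
    omega

lemma flipBit_blockString_of_mem {n i : ℕ} (hi : i < n) (h4 : i < 4) {T : Finset ℕ} (h : i ∈ T) :
    flipBit ⟨i, hi⟩ (blockString n T) = blockString n (T.erase i) := by
  ext a : 1
  by_cases ha : a = ⟨i, hi⟩
  · subst ha
    have : ¬ 4 ≤ i := by omega
    simp [flipBit_self, blockString, h, this]
  · have : (a : ℕ) ≠ i := fun h => ha (Fin.ext h)
    simp [flipBit_of_ne ha, blockString, this]

lemma flipBit_blockString_of_notMem {n i : ℕ} (hi : i < n) (h4 : i < 4) {T : Finset ℕ}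
    (h : i ∉ T) : flipBit ⟨i, hi⟩ (blockString n T) = blockString n (insert i T) := by
  ext a : 1
  by_cases ha : a = ⟨i, hi⟩
  · subst ha
    have : ¬ 4 ≤ i := by omega
    simp [flipBit_self, blockString, h, this]
  · have : (a : ℕ) ≠ i := fun h => ha (Fin.ext h)
    simp [flipBit_of_ne ha, blockString, this]

/-- The part of the product of two Haldane–Shastry weights that is common to the three ways of
splitting `{0, 1, 2, 3}` into pairs. -/
noncomputable def commonWeight (n : ℕ) : ℝ :=
  ∏ a : Fin n, ∏ b ∈ Finset.Ioi a, chordSq n a b ^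
    (if (a : ℕ) < 4 then (if 4 ≤ (b : ℕ) ∧ (b : ℕ) < n / 2 + 2 then 1 else 0)
      else if (b : ℕ) < n / 2 + 2 then 2 else 0)

lemma commonWeight_pos (n : ℕ) : 0 < commonWeight n :=
  Finset.prod_pos fun _ _ => Finset.prod_pos fun b hb =>
    pow_pos (chordSq_pos (Fin.lt_def.mp (Finset.mem_Ioi.mp hb)) b.2) _

/-- Writing one factor as a product over all pairs reduces `hsWeight_mul` to comparing exponents
pair by pair. -/
lemma prod_pairs_ite {n i j : ℕ} (hij : i < j) (hj : j < n) (f : ℕ → ℕ → ℝ) :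
    ∏ a : Fin n, ∏ b ∈ Finset.Ioi a, f a b ^ (if (a : ℕ) = i ∧ (b : ℕ) = j then 1 else 0) =
      f i j := by
  rw [Finset.prod_eq_single ⟨i, by omega⟩, Finset.prod_eq_single ⟨j, hj⟩]
  · simp
  · intro b _ hb
    have : (b : ℕ) ≠ j := fun h => hb (Fin.ext h)
    simp [this]
  · intro h
    exact absurd (Finset.mem_Ioi.mpr (Fin.lt_def.mpr hij)) h
  · intro a _ ha
    have : (a : ℕ) ≠ i := fun h => ha (Fin.ext h)
    simp [this]
  · simp

/-- Each of the first four sites is occupied in exactly one of the two strings and each block site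
in both. So a pair inside the block has exponent `2` and a site–block pair exponent `1`, whatever
the splitting; only the chords `i j` and `k l` depend on it. -/
lemma hsWeight_mul {n i j k l : ℕ} (hn : 4 ≤ n) (hij : i < j) (hkl : k < l)
    (hmem : ∀ a, a < 4 ↔ (a = i ∨ a = j ∨ a = k ∨ a = l)) :
    hsWeight n (blockString n {i, j}) * hsWeight n (blockString n {k, l}) =
      commonWeight n * chordSq n i j * chordSq n k l := by
  have h0 := (hmem 0).mp (by norm_num)
  have h1 := (hmem 1).mp (by norm_num)
  have h2 := (hmem 2).mp (by norm_num)
  have h3 := (hmem 3).mp (by norm_num)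
  have hik : i ≠ k := by omega
  have hil : i ≠ l := by omega
  have hjk : j ≠ k := by omega
  have hjl : j ≠ l := by omega
  have hj := (hmem j).mpr (by simp)
  have hl := (hmem l).mpr (by simp)
  rw [← prod_pairs_ite hij (by omega : j < n) (chordSq n),
    ← prod_pairs_ite hkl (by omega : l < n) (chordSq n), hsWeight_eq, hsWeight_eq, commonWeight]
  simp only [← Finset.prod_mul_distrib, ← pow_add]
  refine Finset.prod_congr rfl fun a _ => Finset.prod_congr rfl fun b hb => ?_
  congr 1
  have hab : (a : ℕ) < b := Fin.lt_def.mp (Finset.mem_Ioi.mp hb)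
  have ha4 := hmem a
  have hb4 := hmem b
  have hbit : ∀ (T : Finset ℕ) (c : Fin n), ((blockString n T c : Fin 2) : ℕ) =
      if (c : ℕ) ∈ T ∨ (4 ≤ (c : ℕ) ∧ (c : ℕ) < n / 2 + 2) then 1 else 0 := fun T c => by
    rw [blockString]
    split_ifs <;> rfl
  simp only [hbit, Finset.mem_insert, Finset.mem_singleton]
  generalize (a : ℕ) = a at *
  generalize (b : ℕ) = b at *
  grind

/-- Ptolemy's theorem makes the squared chords of four consecutive sites violate the triangle
inequality. -/
lemma chordSq_lt {n : ℕ} (hn : 4 ≤ n) :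
    chordSq n 0 1 * chordSq n 2 3 + chordSq n 0 3 * chordSq n 1 2 <
      chordSq n 0 2 * chordSq n 1 3 := by
  set α := Real.pi / n with hα
  have hc : ∀ a b : ℕ, chordSq n a b = Real.sin (((b : ℝ) - a) * α) ^ 2 := fun a b => by
    have : Real.pi * ((a : ℝ) - b) / n = -(((b : ℝ) - a) * α) := by rw [hα]; ring
    rw [chordSq, this, Real.sin_neg, neg_sq]
  have h1 : 0 < Real.sin α ^ 2 := by
    have := chordSq_pos (n := n) (a := 0) (b := 1) (by omega) (by omega)
    rw [hc] at this
    norm_num at this ⊢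
    exact this
  have hn' : (4 : ℝ) ≤ n := by exact_mod_cast hn
  have hpos : 0 < α := div_pos Real.pi_pos (by linarith)
  have hle : 4 * α ≤ Real.pi := by
    rw [hα, ← mul_div_assoc, div_le_iff₀ (by linarith)]
    nlinarith [Real.pi_pos]
  have hs1 : 0 < Real.sin α := Real.sin_pos_of_pos_of_lt_pi hpos (by linarith)
  have hs3 : 0 < Real.sin (3 * α) := Real.sin_pos_of_pos_of_lt_pi (by linarith) (by linarith)
  -- Ptolemy for sites `0, 1, 2, 3`: diagonals `sin 2α`, sides `sin α` three times and `sin 3α`.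
  have hpt : Real.sin (2 * α) ^ 2 = Real.sin α ^ 2 + Real.sin (3 * α) * Real.sin α := by
    rw [Real.sin_three_mul, Real.sin_two_mul, mul_pow, mul_pow, Real.cos_sq']
    ring
  simp only [hc]
  norm_num
  have h2 : Real.sin (2 * α) ^ 2 * Real.sin (2 * α) ^ 2 =
      (Real.sin α ^ 2 + Real.sin (3 * α) * Real.sin α) ^ 2 := by rw [hpt]; ring
  -- Half the cross term produced by squaring Ptolemy's identity.
  have h3 := mul_pos (mul_pos h1 hs3) hs1
  nlinarith

/-! ### The three-term relation. -/

lemma sum_bitSign {n : ℕ} (x : Fin n → Fin 2) :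
    ∑ q, bitSign (x q) = n - 2 * (hammingWeight x : ℂ) := by
  have h : ∀ b : Fin 2, bitSign b = 1 - 2 * ((b : ℕ) : ℂ) := fun b => by
    fin_cases b <;> norm_num [bitSign]
  simp [h, hammingWeight, Finset.mul_sum]

lemma blockString_of_lt {n : ℕ} {T : Finset ℕ} {q : Fin n} (hq : (q : ℕ) < 4) :
    blockString n T q = if (q : ℕ) ∈ T then 1 else 0 := by
  have : ¬ 4 ≤ (q : ℕ) := by omega
  simp [blockString, this]

lemma blockString_of_ge {n : ℕ} {T : Finset ℕ} (hT : T ⊆ Finset.range 4) {q : Fin n}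
    (hq : 4 ≤ (q : ℕ)) : blockString n T q = if (q : ℕ) < n / 2 + 2 then 1 else 0 := by
  have : (q : ℕ) ∉ T := fun h => by
    have := Finset.mem_range.mp (hT h)
    omega
  simp [blockString, hq, this]

/-- The three-term quadratic relation of fixed-weight free-fermion states, as a triangle
inequality between the moduli of its terms. -/
lemma IsFreeFermionState.norm_mul_le {n : ℕ} (hn : 4 ≤ n) (heven : 2 ∣ n) {φ : QubitVec n}
    (hφ : IsFreeFermionState φ) (hw : ∀ x, φ x ≠ 0 → hammingWeight x = n / 2) :
    ‖φ (blockString n {0, 2})‖ * ‖φ (blockString n {1, 3})‖ ≤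
      ‖φ (blockString n {1, 2})‖ * ‖φ (blockString n {0, 3})‖ +
        ‖φ (blockString n {0, 1})‖ * ‖φ (blockString n {2, 3})‖ := by
  have hz : ∀ x, φ x ≠ 0 → ∑ q, bitSign (x q) = 0 := fun x hx => by
    rw [sum_bitSign, hw x hx, sub_eq_zero]
    have : n = 2 * (n / 2) := (Nat.mul_div_cancel' heven).symm
    exact_mod_cast this
  -- The weights are `n / 2 + 1` and `n / 2 - 1`, so flipping site `0`, `1` or `2` in both strings
  -- brings both to `n / 2`.
  have h := hφ.majoranaTensor_eq_zero hz (blockString n {0, 1, 2}) (blockString n {3})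
  rw [majoranaTensor_apply] at h
  set t : Fin n → ℂ := fun q => jwSign q (blockString n {0, 1, 2}) * jwSign q (blockString n {3}) *
    (1 - bitSign (blockString n {0, 1, 2} q) * bitSign (blockString n {3} q)) *
      (φ (flipBit q (blockString n {0, 1, 2})) * φ (flipBit q (blockString n {3}))) with ht
  have h' : t ⟨0, by omega⟩ + (t ⟨1, by omega⟩ + t ⟨2, by omega⟩) = 0 := by
    rw [← Finset.sum_pair (f := t) (by simp), ← Finset.sum_insert (f := t) (by simp), ← h]
    refine Finset.sum_subset (Finset.subset_univ _) fun q _ hq => ?_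
    simp only [Finset.mem_insert, Finset.mem_singleton, Fin.ext_iff, not_or] at hq
    rcases lt_or_ge (q : ℕ) 4 with h4 | h4
    · have hq3 : q = ⟨3, by omega⟩ := Fin.ext (by simp only; omega)
      have h0 : φ (flipBit q (blockString n {3})) = 0 := by
        by_contra hne
        have hwt := hw _ hne
        rw [hq3, flipBit_blockString_of_mem (by omega) (by norm_num) (by simp),
          hammingWeight_blockString hn (by decide)] at hwt
        have : (({3} : Finset ℕ).erase 3).card = 0 := by decide
        omega
      simp only [ht, h0, mul_zero]
    · simp only [ht]
      -- The strings agree from site `4` on, so the factor `1 - bitSign * bitSign` is zero.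
      rw [blockString_of_ge (by decide) h4, blockString_of_ge (by decide) h4, bitSign_mul_self,
        sub_self, mul_zero, zero_mul]
  have hnorm : ∀ (i : ℕ) (hi : i < 3) (A B : Finset ℕ), ({0, 1, 2} : Finset ℕ).erase i = A →
      insert i {3} = B →
      ‖t ⟨i, by omega⟩‖ = 2 * (‖φ (blockString n A)‖ * ‖φ (blockString n B)‖) := by
    intro i hi A B hA hB
    have hm : i ∈ ({0, 1, 2} : Finset ℕ) := by simp; omega
    have hm' : i ∉ ({3} : Finset ℕ) := by simp; omega
    simp only [ht]
    rw [flipBit_blockString_of_mem (by omega) (by omega) hm,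
      flipBit_blockString_of_notMem (by omega) (by omega) hm', hA, hB,
      blockString_of_lt (by simp only; omega), blockString_of_lt (by simp only; omega),
      if_pos hm, if_neg hm', norm_mul, norm_mul, norm_mul, norm_mul, norm_jwSign, norm_jwSign]
    norm_num [bitSign]
  have e0 := hnorm 0 (by norm_num) {1, 2} {0, 3} (by decide) (by decide)
  have e1 := hnorm 1 (by norm_num) {0, 2} {1, 3} (by decide) (by decide)
  have e2 := hnorm 2 (by norm_num) {0, 1} {2, 3} (by decide) (by decide)
  have hle : ‖t ⟨1, by omega⟩‖ ≤ ‖t ⟨0, by omega⟩‖ + ‖t ⟨2, by omega⟩‖ := by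
    have : t ⟨1, by omega⟩ = -(t ⟨0, by omega⟩ + t ⟨2, by omega⟩) := by linear_combination h'
    rw [this, norm_neg]
    exact norm_add_le _ _
  rw [e0, e1, e2] at hle
  linarith

end FreeFermion

/-! ### Contradiction with Ptolemy. -/

theorem mainTheorem6 (n : ℕ) (hn : 4 ≤ n) (hdvd : 4 ∣ n) (θ : (Fin n → Fin 2) → ℝ) :
    ¬ ∃ φ : FreeFermion.QubitVec n, FreeFermion.IsFreeFermionState φ ∧
      ∃ c : ℂ, FreeFermion.haldaneShastry n θ = c • φ := by
  open FreeFermion in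
  rintro ⟨φ, hφ, c, hc⟩
  have hw : c ≠ 0 → ∀ x, φ x ≠ 0 → hammingWeight x = n / 2 := by
    intro hc0 x hx
    by_contra hne
    have h := congrFun hc x
    rw [haldaneShastry, if_neg hne, Pi.smul_apply, smul_eq_mul] at h
    exact mul_ne_zero hc0 hx h.symm
  have hnorm : ∀ i j : ℕ, i < j → j < 4 →
      ‖c‖ * ‖φ (blockString n {i, j})‖ = hsWeight n (blockString n {i, j}) := by
    intro i j hij hj
    have hwt : hammingWeight (blockString n {i, j}) = n / 2 := by
      rw [hammingWeight_blockString hn, Finset.card_pair hij.ne]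
      · omega
      · intro a ha
        simp only [Finset.mem_insert, Finset.mem_singleton] at ha
        exact Finset.mem_range.mpr (by omega)
    rw [← norm_haldaneShastry θ _ hwt, hc, Pi.smul_apply, smul_eq_mul, norm_mul]
  have m1 := hsWeight_mul (n := n) (i := 0) (j := 1) (k := 2) (l := 3) hn (by norm_num)
    (by norm_num) (by omega)
  have m2 := hsWeight_mul (n := n) (i := 0) (j := 2) (k := 1) (l := 3) hn (by norm_num)
    (by norm_num) (by omega)
  have m3 := hsWeight_mul (n := n) (i := 0) (j := 3) (k := 1) (l := 2) hn (by norm_num)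
    (by norm_num) (by omega)
  rw [← hnorm _ _ (by norm_num) (by norm_num), ← hnorm _ _ (by norm_num) (by norm_num)] at m1 m2 m3
  have hK := commonWeight_pos n
  have hlt := mul_lt_mul_of_pos_left (chordSq_lt hn) hK
  have h02 := mul_pos (mul_pos hK (chordSq_pos (n := n) (a := 0) (b := 2) (by norm_num) (by omega)))
    (chordSq_pos (n := n) (a := 1) (b := 3) (by norm_num) (by omega))
  -- With `c = 0` the left side of `m2` would be zero, while its right side is positive.
  have hc0 : c ≠ 0 := by
    rintro rfl
    rw [← m2, norm_zero] at h02
    simp at h02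
  -- The factor `‖c‖ ^ 2` turns products of two moduli of `φ` into products of two Haldane–Shastry
  -- weights.
  have htri := mul_le_mul_of_nonneg_left
    (hφ.norm_mul_le hn (dvd_trans (by norm_num) hdvd) (hw hc0)) (sq_nonneg ‖c‖)
  linarith
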